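/- All rings are commutative with $1\neq 0$. For a ring $R$ let $Z(R)=\{x\in R : xy=0 \text{ for some } y\neq 0\}$ be its set of zero-divisors (so $0\in Z(R)$), let $\mathrm{Nil}(R)$ be its nilradical, and let $\mathbb{CAY}(R)=\mathrm{Cay}(R^+,Z(R)\setminus\{0\})$ be the simple graph with vertex set $R$ in which two distinct vertices $x,y$ are adjacent if and only if $x-y\in Z(R)$. For a graph $G$ with at least two vertices, the vertex connectivity $\kappa(G)$ is the largest $k$ such that any two distinct vertices of $G$ are joined by $k$ distinct pairwise internally disjoint paths, and the edge connectivity $\kappa'(G)$ is the largest $k$ such that $G$ remains connected after the removal of any set of fewer than $k$ edges. **Theorem.** Let $R$ be a finite non-local ring, that is, a finite ring with at least two maximal ideals. Then $$\kappa(\mathbb{CAY}(R))=|Z(R)|-|\mathrm{Nil}(R)|\qquad\text{and}\qquad \kappa'(\mathbb{CAY}(R))=|Z(R)|-1 .$$ -/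

import Mathlib

/-- `Z(R)`: the set of zero-divisors of a commutative ring (`0` included when `R` is nontrivial). -/
def zeroDivisorSet (R : Type*) [CommRing R] : Set R :=
  {x | ∃ y : R, y ≠ 0 ∧ x * y = 0}

/-- The Cayley graph of the additive group of `R` with respect to the nonzero zero-divisors. -/
def zeroDivisorCayley (R : Type*) [CommRing R] : SimpleGraph R :=
  SimpleGraph.addCayley (zeroDivisorSet R \ {0})

namespace SimpleGraph

variable {V : Type*}

/-- The internal vertices of a path from `u` to `v`: its vertices other than `u` and `v`. -/
def Path.internalVertices {G : SimpleGraph V} {u v : V} (p : G.Path u v) : Set V :=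
  {w | w ∈ (p : G.Walk u v).support ∧ w ≠ u ∧ w ≠ v}

/-- There are `k` distinct, pairwise internally disjoint paths from `u` to `v`. -/
def HasInternallyDisjointPaths (G : SimpleGraph V) (k : ℕ) (u v : V) : Prop :=
  ∃ P : Fin k → G.Path u v, Function.Injective P ∧
    ∀ i j, i ≠ j → Disjoint (P i).internalVertices (P j).internalVertices

/-- `G` is `k`-connected: any two distinct vertices are joined by `k` pairwise internally disjoint
paths. By convention a graph with at most one vertex is `k`-connected only for `k ≤ 1`. -/
def IsVertexConnected (G : SimpleGraph V) (k : ℕ) : Prop :=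
  (Nontrivial V ∨ k ≤ 1) ∧ ∀ u v : V, u ≠ v → G.HasInternallyDisjointPaths k u v

/-- The vertex connectivity `κ(G)`: the largest `k` such that `G` is `k`-connected (`⊤` if there is
no largest one). -/
noncomputable def vertexConnectivity (G : SimpleGraph V) : ℕ∞ :=
  ⨆ (k : ℕ) (_ : G.IsVertexConnected k), (k : ℕ∞)

/-- The edge connectivity `κ'(G)`: the largest `k` such that no removal of fewer than `k` edges
disconnects `G` (`⊤` if there is no largest one). By convention a graph with at most one vertex is
`k`-edge-connected only for `k ≤ 1`. -/
noncomputable def edgeConnectivity (G : SimpleGraph V) : ℕ∞ :=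
  ⨆ (k : ℕ) (_ : (Nontrivial V ∨ k ≤ 1) ∧ G.IsEdgeConnected k), (k : ℕ∞)

end SimpleGraph

/-!
In a finite ring the zero-divisors are the non-units, that is, the elements of the union of the
maximal ideals, while the nilradical is the intersection of the maximal ideals. Write `Z` for the
former and `N` for the latter.

*Vertex connectivity, upper bound.* The neighbours of `N` outside `N` all lie in `Z \ N`, because
`Z + N ⊆ Z`. Hence every path from `0` to `1` has an internal vertex in `Z \ N`, and internally
disjoint paths have different ones (`HasInternallyDisjointPaths.le_card_of_separates`).

*Vertex connectivity, lower bound.* Let `u ≠ v` and `d = v - u`. Every `z ∈ Z \ N` gives one path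
starting with the edge from `u` to `u + z`. If `z = d` this is already a path to `v`, and if
`z - d ∈ Z` one more edge completes it. In the remaining case `z` and `d` differ in every residue
field. Let `A` be the set of maximal ideals containing `z`; it is neither empty nor everything. Let
`w` agree with `d` in the residue fields of `A` and with `z` in the others, by adding to `z` an
element `d * ε A`, where `ε A` is `1` at `A` and `0` elsewhere. Then `z - w` and `w - d` are in `Z`,
while `w` is a unit, so `u, u + z, u + w, v` is a path. Moreover `A` is the set of places where `w`
agrees with `d`, so `w` determines `z`: the paths are internally disjoint
(`exists_matching_of_ne`, `hasInternallyDisjointPaths_of_matching`).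

*Edge connectivity.* It is at most the degree, which is `|Z| - 1`. As the ring is not local, `1` is
a sum of two elements of `Z`, hence so is every element, and any two non-adjacent vertices have a
common neighbour. In such a graph the edge connectivity is the minimum degree
(`isEdgeConnected_of_common_neighbor`): one side of any cut consists of vertices that all have
neighbours across it, and such a cut has at least as many edges as a vertex on that side has
neighbours (`encard_neighborSet_le_of_cut`).
-/

/-! ### Internally disjoint paths -/

namespace SimpleGraph

variable {V : Type*} {G : SimpleGraph V}

/-- The easy half of Menger's theorem. -/
lemma HasInternallyDisjointPaths.le_card_of_separates {k : ℕ} {u v : V} {T : Set V}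
    (h : G.HasInternallyDisjointPaths k u v) (hT : T.Finite)
    (hsep : ∀ p : G.Path u v, ∃ w ∈ p.internalVertices, w ∈ T) : k ≤ Nat.card T := by
  obtain ⟨P, -, hP⟩ := h
  choose f hf hfT using fun i ↦ hsep (P i)
  have : Finite T := hT
  have hinj : Function.Injective fun i ↦ (⟨f i, hfT i⟩ : T) := fun i j hij ↦ by
    by_contra hne
    have hij : f i = f j := congrArg Subtype.val hij
    exact Set.disjoint_left.1 (hP i j hne) (hf i) (hij ▸ hf j)
  simpa using Nat.card_le_card_of_injective _ hinj

/-- If every element of a set `T` of neighbours of `u` is `v`, or a neighbour of `v`, or is matched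
by `σ` to a neighbour of `v` that is not a neighbour of `u`, then there are `|T|` internally disjoint
paths of length at most three from `u` to `v`. -/
lemma hasInternallyDisjointPaths_of_matching {u v : V} (huv : u ≠ v) {T : Set V} (hT : T.Finite)
    (σ : V → V) (hadj : ∀ z ∈ T, G.Adj u z)
    (hσ : ∀ z ∈ T, z ≠ v → ¬ G.Adj z v →
      G.Adj z (σ z) ∧ G.Adj (σ z) v ∧ ¬ G.Adj u (σ z) ∧ σ z ≠ u)
    (hinj : Set.InjOn σ {z ∈ T | z ≠ v ∧ ¬ G.Adj z v}) :
    G.HasInternallyDisjointPaths (Nat.card T) u v := by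
  have key : ∀ z : T, ∃ p : G.Path u v, ((z : V) ≠ v → (z : V) ∈ p.internalVertices) ∧
      ∀ w ∈ p.internalVertices, (z : V) ≠ v ∧ (w = z ∨ (¬ G.Adj z v ∧ w = σ z)) := by
    rintro ⟨z, hz⟩
    dsimp only
    have huz := hadj z hz
    by_cases hzv : z = v
    · subst hzv
      refine ⟨⟨.cons huz .nil, by simp [huv]⟩, by simp, ?_⟩
      rintro w ⟨hw, hwu, hwv⟩
      simp [hwu, hwv] at hw
    by_cases hzv' : G.Adj z v
    · refine ⟨⟨.cons huz (.cons hzv' .nil), by simp [huv, hzv, huz.ne]⟩,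
        fun _ ↦ ⟨by simp, huz.ne', hzv⟩, ?_⟩
      rintro w ⟨hw, hwu, hwv⟩
      simp only [Walk.support_cons, Walk.support_nil, List.mem_cons, List.not_mem_nil, or_false,
        hwu, hwv, false_or] at hw
      exact ⟨hzv, .inl hw⟩
    obtain ⟨h1, h2, h3, h4⟩ := hσ z hz hzv hzv'
    refine ⟨⟨.cons huz (.cons h1 (.cons h2 .nil)), by
      simp [huv, hzv, huz.ne, h1.ne, h2.ne, h4.symm]⟩, fun _ ↦ ⟨by simp, huz.ne', hzv⟩, ?_⟩
    rintro w ⟨hw, hwu, hwv⟩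
    simp only [Walk.support_cons, Walk.support_nil, List.mem_cons, List.not_mem_nil, or_false,
      hwu, hwv, false_or] at hw
    exact ⟨hzv, hw.imp_right fun h ↦ ⟨hzv', h⟩⟩
  choose P hP hP' using key
  have hdisj : ∀ z z' : T, z ≠ z' →
      Disjoint (P z).internalVertices (P z').internalVertices := by
    rintro ⟨z, hz⟩ ⟨z', hz'⟩ hne
    replace hne : z ≠ z' := fun h ↦ hne (Subtype.ext h)
    refine Set.disjoint_left.2 fun w hw hw' ↦ ?_
    obtain ⟨hzv, h₁⟩ := hP' _ w hw
    obtain ⟨hzv', h₂⟩ := hP' _ w hw'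
    dsimp only at hzv hzv' h₁ h₂
    obtain rfl | ⟨hn, rfl⟩ := h₁ <;> obtain h | ⟨hn', h⟩ := h₂
    · exact hne h
    · exact (hσ z' hz' hzv' hn').2.2.1 (h ▸ hadj w hz)
    · exact (hσ z hz hzv hn).2.2.1 (h ▸ hadj z' hz')
    · exact hne (hinj ⟨hz, hzv, hn⟩ ⟨hz', hzv', hn'⟩ h)
  -- Equal paths with different indices would have no internal vertex, but only the index `v`
  -- gives such a path.
  have hPinj : Function.Injective P := by
    intro z z' h
    by_contra hne
    have hd := hdisj z z' hne
    rw [h, disjoint_self] at hd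
    have hempty : ∀ x : T, P x = P z' → (x : V) = v := by
      intro x hx
      by_contra hxv
      have hmem := hP x hxv
      rw [hx, hd] at hmem
      exact hmem
    exact hne (Subtype.ext ((hempty z h).trans (hempty z' rfl).symm))
  have : Finite T := hT
  let e := (Finite.equivFin T).symm
  exact ⟨fun i ↦ P (e i), hPinj.comp e.injective, fun i j hij ↦ hdisj _ _ (e.injective.ne hij)⟩

lemma vertexConnectivity_eq {k : ℕ} (hk : G.IsVertexConnected k)
    (hmax : ∀ l, G.IsVertexConnected l → l ≤ k) : G.vertexConnectivity = k :=
  le_antisymm (iSup₂_le fun l hl ↦ by exact_mod_cast hmax l hl)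
    (le_iSup₂_of_le k hk le_rfl)

/-! ### Edge cuts in graphs of diameter two -/

/-- Let `s` contain all edges leaving `S`. If every vertex of `S` has a neighbour outside `S`, then
the neighbours of `x ∈ S` inject into `s`: send a neighbour outside `S` to its edge to `x`, and one
inside `S` to an edge from it that leaves `S`. -/
lemma encard_neighborSet_le_of_cut {S : Set V} {s : Set (Sym2 V)}
    (hs : ∀ a ∈ S, ∀ b ∉ S, G.Adj a b → s(a, b) ∈ s) {x : V} (hx : x ∈ S)
    (hS : ∀ a ∈ S, ∃ b ∉ S, G.Adj a b) : (G.neighborSet x).encard ≤ s.encard := by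
  classical
  choose! g hg hag using hS
  refine Set.encard_le_encard_of_injOn
    (f := fun y ↦ if y ∈ S then s(y, g y) else s(x, y)) (fun y hy ↦ ?_) ?_
  · dsimp only
    split_ifs with h
    · exact hs _ h _ (hg y h) (hag y h)
    · exact hs _ hx _ h hy
  · intro y hy y' hy' h
    have hxy : x ≠ y := G.ne_of_adj hy
    have hxy' : x ≠ y' := G.ne_of_adj hy'
    dsimp only at h
    split_ifs at h with h1 h2 h2 <;> rw [Sym2.eq_iff] at h <;> grind

/-- Plesník's theorem: a graph of diameter at most two is as edge-connected as its minimum degree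
allows. -/
lemma isEdgeConnected_of_common_neighbor {k : ℕ} (hdeg : ∀ x, (k : ℕ∞) ≤ (G.neighborSet x).encard)
    (hdiam : ∀ x y, x ≠ y → ¬ G.Adj x y → ∃ z, G.Adj x z ∧ G.Adj z y) : G.IsEdgeConnected k := by
  intro u v s hsk
  by_contra hr
  set S : Set V := {w | (G.deleteEdges s).Reachable u w} with hS
  have hu : u ∈ S := Reachable.rfl
  have hs : ∀ a ∈ S, ∀ b ∉ S, G.Adj a b → s(a, b) ∈ s := by
    intro a ha b hb hab
    by_contra hmem
    exact hb (Reachable.trans ha (Adj.reachable (deleteEdges_adj.2 ⟨hab, hmem⟩)))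
  refine absurd hsk (not_lt.2 ?_)
  by_cases hcross : ∀ a ∈ S, ∃ b ∉ S, G.Adj a b
  · exact (hdeg u).trans (encard_neighborSet_le_of_cut hs hu hcross)
  -- A vertex of `S` without neighbours in the complement shares a neighbour, necessarily in `S`,
  -- with every vertex of the complement.
  push Not at hcross
  obtain ⟨a, ha, hab⟩ := hcross
  refine (hdeg v).trans (encard_neighborSet_le_of_cut (S := Sᶜ) (fun x hx y hy hxy ↦ ?_) hr ?_)
  · rw [Sym2.eq_swap]
    exact hs y (not_not.1 hy) x hx hxy.symm
  · intro b hb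
    obtain ⟨z, haz, hzb⟩ := hdiam a b (fun h ↦ hb (h ▸ ha)) (hab b hb)
    exact ⟨z, fun hz ↦ hab z hz haz, hzb.symm⟩

lemma edgeConnectivity_eq [Nontrivial V] {k : ℕ} (hk : G.IsEdgeConnected k)
    (hmax : ∀ l, G.IsEdgeConnected l → l ≤ k) : G.edgeConnectivity = k :=
  le_antisymm (iSup₂_le fun l hl ↦ by exact_mod_cast hmax l hl.2)
    (le_iSup₂_of_le k ⟨.inl inferInstance, hk⟩ le_rfl)

end SimpleGraph

/-! ### Zero-divisors and maximal ideals of a finite ring -/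

section Ring

variable {R : Type*} [CommRing R]

lemma not_isUnit_iff_exists_mem_maximal {x : R} :
    ¬ IsUnit x ↔ ∃ m : MaximalSpectrum R, x ∈ m.asIdeal := by
  constructor
  · intro h
    obtain ⟨m, hm, hx⟩ := exists_max_ideal_of_mem_nonunits h
    exact ⟨⟨m, hm⟩, hx⟩
  · rintro ⟨m, hx⟩ h
    exact m.isMaximal.ne_top (Ideal.eq_top_of_isUnit_mem _ hx h)

variable [Finite R]

lemma mem_zeroDivisorSet_iff {x : R} : x ∈ zeroDivisorSet R ↔ ¬ IsUnit x := by
  rw [isUnit_iff_mem_nonZeroDivisors_of_finite, mem_nonZeroDivisors_iff_right]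
  simp only [zeroDivisorSet, Set.mem_ofPred_eq]
  push Not
  exact exists_congr fun y ↦ by rw [mul_comm, and_comm]

lemma mem_nilradical_iff_forall_mem_maximal {x : R} :
    x ∈ nilradical R ↔ ∀ m : MaximalSpectrum R, x ∈ m.asIdeal := by
  rw [nilradical_eq_sInf, Ideal.mem_sInf]
  exact ⟨fun h m ↦ h m.isMaximal.isPrime,
    fun h J hJ ↦ h ⟨J, IsArtinianRing.isPrime_iff_isMaximal J |>.1 hJ⟩⟩

lemma exists_indicator_maximal (A : Set (MaximalSpectrum R)) :
    ∃ e : R, (∀ m ∈ A, e - 1 ∈ m.asIdeal) ∧ ∀ m ∉ A, e ∈ m.asIdeal := by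
  classical
  have hcop : Pairwise (Function.onFun IsCoprime fun m : MaximalSpectrum R ↦ m.asIdeal) :=
    fun m n hmn ↦ (Ideal.isCoprime_iff_sup_eq).2
      (m.isMaximal.coprime_of_ne n.isMaximal fun h ↦ hmn (MaximalSpectrum.ext h))
  obtain ⟨e, he⟩ := Ideal.exists_forall_sub_mem_ideal hcop fun m ↦ if m ∈ A then 1 else 0
  exact ⟨e, fun m hm ↦ by simpa [hm] using he m, fun m hm ↦ by simpa [hm] using he m⟩

lemma exists_add_eq_of_not_isLocalRing [Nontrivial R] (hR : ¬ IsLocalRing R) (d : R) :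
    ∃ a b : R, ¬ IsUnit a ∧ ¬ IsUnit b ∧ a + b = d := by
  by_contra! h
  refine hR (IsLocalRing.of_nonunits_add fun a b ha hb hab ↦ ?_)
  obtain ⟨c, hc⟩ := hab.dvd (a := d)
  refine h (a * c) (b * c) (fun h ↦ ha (isUnit_of_mul_isUnit_left h))
    (fun h ↦ hb (isUnit_of_mul_isUnit_left h)) ?_
  rw [hc, add_mul]

lemma nilradical_subset_zeroDivisorSet [Nontrivial R] :
    (nilradical R : Set R) ⊆ zeroDivisorSet R := fun _ hx ↦
  mem_zeroDivisorSet_iff.2 (IsNilpotent.not_isUnit hx)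

/-- The matching behind the paths of length three. For `d ≠ z` in every residue field and `z`
neither a unit nor nilpotent, `σ z` agrees with `d` in the residue fields where `z` vanishes, and
with `z` in the others. -/
lemma exists_matching_of_ne (d : R) :
    ∃ σ : R → R, Set.InjOn σ {z | IsUnit (z - d)} ∧
      ∀ z, ¬ IsUnit z → z ∉ nilradical R → IsUnit (z - d) →
        IsUnit (σ z) ∧ ¬ IsUnit (z - σ z) ∧ ¬ IsUnit (σ z - d) ∧ σ z ≠ d := by
  choose ε hε₁ hε₀ using exists_indicator_maximal (R := R)
  let A (z : R) : Set (MaximalSpectrum R) := {m | z ∈ m.asIdeal}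
  have hA : ∀ z m, m ∈ A z → z + d * ε (A z) - d ∈ m.asIdeal := fun z m hm ↦ by
    have : z + d * ε (A z) - d = z + d * (ε (A z) - 1) := by ring
    exact this ▸ add_mem hm (Ideal.mul_mem_left _ _ (hε₁ _ m hm))
  have hA' : ∀ z m, m ∉ A z → d * ε (A z) ∈ m.asIdeal := fun z m hm ↦
    Ideal.mul_mem_left _ _ (hε₀ _ m hm)
  have hunit : ∀ {z}, IsUnit (z - d) → ∀ m : MaximalSpectrum R, z - d ∉ m.asIdeal :=
    fun h m hm ↦ not_isUnit_iff_exists_mem_maximal.2 ⟨m, hm⟩ h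
  -- The places where `σ z` agrees with `d` are exactly those where `z` vanishes.
  have hA_iff : ∀ {z}, IsUnit (z - d) → ∀ m : MaximalSpectrum R,
      z + d * ε (A z) - d ∈ m.asIdeal ↔ m ∈ A z := fun {z} h m ↦ by
    refine ⟨fun hm ↦ ?_, hA z m⟩
    by_contra hmA
    refine hunit h m ?_
    have : z - d = z + d * ε (A z) - d - d * ε (A z) := by ring
    exact this ▸ sub_mem hm (hA' z m hmA)
  refine ⟨fun z ↦ z + d * ε (A z), ?_, fun z hz hzN hzd ↦ ?_⟩
  · intro z hz z' hz' h
    dsimp only at h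
    have hAA : A z = A z' := Set.ext fun m ↦ by rw [← hA_iff hz, ← hA_iff hz', h]
    rw [hAA] at h
    exact add_right_cancel h
  obtain ⟨m, hm⟩ := not_isUnit_iff_exists_mem_maximal.1 hz
  rw [mem_nilradical_iff_forall_mem_maximal] at hzN
  push Not at hzN
  obtain ⟨n, hn⟩ := hzN
  refine ⟨?_, ?_, not_isUnit_iff_exists_mem_maximal.2 ⟨m, hA z m hm⟩, fun h ↦ ?_⟩
  · by_contra hσ
    obtain ⟨l, hl⟩ := not_isUnit_iff_exists_mem_maximal.1 hσ
    by_cases hlA : l ∈ A z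
    · refine hunit hzd l ?_
      have : z - d = z + (z + d * ε (A z) - d) - (z + d * ε (A z)) := by ring
      exact this ▸ sub_mem (add_mem hlA (hA z l hlA)) hl
    · exact hlA ((Submodule.add_mem_iff_left _ (hA' z l hlA)).1 hl)
  · refine not_isUnit_iff_exists_mem_maximal.2 ⟨n, ?_⟩
    rw [sub_add_cancel_left]
    exact neg_mem (hA' z n hn)
  · exact hn ((hA_iff hzd n).1 (by simp [h]))

/-! ### The Cayley graph of the zero-divisors -/

lemma zeroDivisorCayley_adj {x y : R} :
    (zeroDivisorCayley R).Adj x y ↔ x ≠ y ∧ ¬ IsUnit (y - x) := by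
  rw [zeroDivisorCayley, SimpleGraph.addCayley_adj', and_congr_right_iff]
  intro hxy
  constructor
  · rintro ⟨g, ⟨hg, -⟩, rfl | rfl⟩
    · simpa using mem_zeroDivisorSet_iff.1 hg
    · simpa using mem_zeroDivisorSet_iff.1 hg
  · exact fun h ↦ ⟨y - x, ⟨mem_zeroDivisorSet_iff.2 h, sub_ne_zero.2 hxy.symm⟩, by simp⟩

lemma encard_neighborSet_zeroDivisorCayley [Nontrivial R] (x : R) :
    ((zeroDivisorCayley R).neighborSet x).encard =
      ((Nat.card (zeroDivisorSet R) - 1 : ℕ) : ℕ∞) := by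
  have h : (zeroDivisorCayley R).neighborSet x = (x + ·) '' (zeroDivisorSet R \ {0}) := by
    ext y
    rw [SimpleGraph.mem_neighborSet, zeroDivisorCayley_adj]
    constructor
    · exact fun ⟨hne, h⟩ ↦ ⟨y - x, ⟨mem_zeroDivisorSet_iff.2 h, sub_ne_zero.2 hne.symm⟩, by simp⟩
    · rintro ⟨z, ⟨hz, hz0⟩, rfl⟩
      have hz0 : z ≠ 0 := hz0
      exact ⟨by simpa using hz0, by simpa using mem_zeroDivisorSet_iff.1 hz⟩
  have h0 : (0 : R) ∈ zeroDivisorSet R := mem_zeroDivisorSet_iff.2 not_isUnit_zero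
  rw [h, (add_right_injective x).encard_image, ← (Set.toFinite _).cast_ncard_eq,
    Set.ncard_sdiff_singleton_of_mem h0, Nat.card_coe_set_eq]

lemma isEdgeConnected_zeroDivisorCayley [Nontrivial R] (hR : ¬ IsLocalRing R) :
    (zeroDivisorCayley R).IsEdgeConnected (Nat.card (zeroDivisorSet R) - 1) := by
  refine SimpleGraph.isEdgeConnected_of_common_neighbor
    (fun x ↦ (encard_neighborSet_zeroDivisorCayley x).ge) fun x y hxy hn ↦ ?_
  have hu : IsUnit (y - x) := by
    by_contra h
    exact hn (zeroDivisorCayley_adj.2 ⟨hxy, h⟩)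
  obtain ⟨a, b, ha, hb, hab⟩ := exists_add_eq_of_not_isLocalRing hR (y - x)
  refine ⟨x + a, zeroDivisorCayley_adj.2 ⟨fun h ↦ hb ?_, by simpa using ha⟩,
    zeroDivisorCayley_adj.2 ⟨fun h ↦ ha ?_, ?_⟩⟩
  · have : b = y - x := by linear_combination hab + h
    rwa [this]
  · have : a = y - x := by linear_combination h
    rwa [this]
  · have : y - (x + a) = b := by linear_combination -hab
    rwa [this]

lemma isVertexConnected_zeroDivisorCayley [Nontrivial R] :
    (zeroDivisorCayley R).IsVertexConnected
      (Nat.card ↑(zeroDivisorSet R \ (nilradical R : Set R))) := by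
  refine ⟨.inl inferInstance, fun u v huv ↦ ?_⟩
  obtain ⟨σ, hinj, hσ⟩ := exists_matching_of_ne (v - u)
  rw [← Nat.card_image_of_injective (add_right_injective u)]
  have hsub : ∀ z, ¬ (zeroDivisorCayley R).Adj (u + z) v → u + z ≠ v → IsUnit (z - (v - u)) := by
    intro z h hne
    by_contra hz
    refine h (zeroDivisorCayley_adj.2 ⟨hne, fun h ↦ hz ?_⟩)
    have : z - (v - u) = -(v - (u + z)) := by ring
    exact this ▸ h.neg
  refine SimpleGraph.hasInternallyDisjointPaths_of_matching huv (Set.toFinite _)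
    (fun x ↦ u + σ (x - u)) ?_ ?_ ?_
  · rintro _ ⟨z, ⟨hz, hzN⟩, rfl⟩
    refine zeroDivisorCayley_adj.2 ⟨fun h ↦ hzN ?_, by simpa using mem_zeroDivisorSet_iff.1 hz⟩
    have : z = 0 := by simpa using h
    exact this ▸ zero_mem _
  · rintro _ ⟨z, ⟨hz, hzN⟩, rfl⟩ hne hn
    dsimp only at hne hn ⊢
    obtain ⟨h1, h2, h3, h4⟩ := hσ z (mem_zeroDivisorSet_iff.1 hz) hzN (hsub z hn hne)
    rw [add_sub_cancel_left, zeroDivisorCayley_adj, zeroDivisorCayley_adj, zeroDivisorCayley_adj]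
    refine ⟨⟨fun h ↦ ?_, fun h ↦ h2 ?_⟩, ⟨fun h ↦ h4 ?_, fun h ↦ h3 ?_⟩, fun h ↦ h.2 ?_, fun h ↦ ?_⟩
    · exact mem_zeroDivisorSet_iff.1 hz (add_left_cancel h ▸ h1)
    · have : z - σ z = -(u + σ z - (u + z)) := by ring
      exact this ▸ h.neg
    · rw [← h, add_sub_cancel_left]
    · have : σ z - (v - u) = -(v - (u + σ z)) := by ring
      exact this ▸ h.neg
    · simpa using h1
    · have : σ z = 0 := by simpa using h
      exact not_isUnit_zero (this ▸ h1)
  · rintro _ ⟨⟨z, -, rfl⟩, hne, hn⟩ _ ⟨⟨z', -, rfl⟩, hne', hn'⟩ h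
    simp only [add_sub_cancel_left, add_right_inj] at h
    rw [hinj (hsub z hn hne) (hsub z' hn' hne') h]

/-- The vertices in `Z(R) \ Nil(R)` separate `0` from `1`. -/
lemma le_card_of_isVertexConnected_zeroDivisorCayley [Nontrivial R] {k : ℕ}
    (hk : (zeroDivisorCayley R).IsVertexConnected k) :
    k ≤ Nat.card ↑(zeroDivisorSet R \ (nilradical R : Set R)) := by
  refine (hk.2 0 1 zero_ne_one).le_card_of_separates (Set.toFinite _) fun p ↦ ?_
  obtain ⟨e, he, he₁, he₂⟩ := (p : (zeroDivisorCayley R).Walk 0 1).exists_boundary_dart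
    (nilradical R : Set R) (zero_mem _) (fun h ↦ not_isNilpotent_one h)
  have hZ : ¬ IsUnit e.snd := by
    obtain ⟨m, hm⟩ :=
      not_isUnit_iff_exists_mem_maximal.1 (zeroDivisorCayley_adj.1 e.adj).2
    refine not_isUnit_iff_exists_mem_maximal.2 ⟨m, ?_⟩
    exact (Submodule.sub_mem_iff_left _ (mem_nilradical_iff_forall_mem_maximal.1 he₁ m)).1 hm
  exact ⟨e.snd, ⟨SimpleGraph.Walk.dart_snd_mem_support_of_mem_darts _ he,
    fun h ↦ he₂ (h ▸ zero_mem _), fun h ↦ hZ (h ▸ isUnit_one)⟩, mem_zeroDivisorSet_iff.2 hZ, he₂⟩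

end Ring

theorem mainTheorem2 (R : Type*) [CommRing R] [Nontrivial R] [Finite R] (hR : ¬ IsLocalRing R) :
    (zeroDivisorCayley R).vertexConnectivity =
        ((Nat.card (zeroDivisorSet R) - Nat.card (nilradical R) : ℕ) : ℕ∞) ∧
      (zeroDivisorCayley R).edgeConnectivity =
        ((Nat.card (zeroDivisorSet R) - 1 : ℕ) : ℕ∞) := by
  classical
  constructor
  · have hcard : Nat.card ↑(zeroDivisorSet R \ (nilradical R : Set R)) =
        Nat.card (zeroDivisorSet R) - Nat.card (nilradical R) := by
      rw [Nat.card_coe_set_eq, Set.ncard_sdiff nilradical_subset_zeroDivisorSet (Set.toFinite _)]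
      rfl
    rw [← hcard]
    exact SimpleGraph.vertexConnectivity_eq isVertexConnected_zeroDivisorCayley
      fun l hl ↦ le_card_of_isVertexConnected_zeroDivisorCayley hl
  · refine SimpleGraph.edgeConnectivity_eq (isEdgeConnected_zeroDivisorCayley hR) fun l hl ↦ ?_
    have := Fintype.ofFinite R
    have hle := hl.le_degree (u := (0 : R))
    have hdeg := encard_neighborSet_zeroDivisorCayley (0 : R)
    rw [Set.encard_eq_coe_toFinset_card, ← SimpleGraph.neighborFinset_def, SimpleGraph.card_neighborFinset_eq_degree] at hdeg
    rwa [← Nat.cast_injective hdeg]
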